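/- A tree is a partial order $(T,\sqsubseteq)$ in which the set $P_t$ of strict predecessors of each node $t$ is well ordered; $\mathrm{Lev}_\alpha(T)$ is the set of $t$ for which $P_t$ has order type $\alpha$, and the height of $T$ is the least $\alpha$ with $\mathrm{Lev}_\alpha(T)=\emptyset$. Let $T$ be a tree of height $\omega_1$ all of whose levels are countable and which has no uncountable branch (maximal linearly ordered subset). Assume that $T$ is rooted (it has a unique minimal node) and normal: every node is comparable with some node of $\mathrm{Lev}_\alpha(T)$ for each $\alpha<\omega_1$, and if $s,t\in\mathrm{Lev}_\delta(T)$ with $\delta$ a limit ordinal and $P_s=P_t$, then $s=t$. Let $\mathbb P(T)$ be the forcing notion of finite partial functions $p:T\to\omega$ such that $p(s)\neq p(t)$ whenever $s\sqsubset t$ are in $\mathrm{dom}(p)$, ordered by reverse inclusion. Then every countable set of ordinals added by $\mathbb P(T)$ lies in a Cohen subextension: whenever $p\in\mathbb P(T)$ and $\dot x$ is a $\mathbb P(T)$-name such that $p$ forces "$\dot x$ is a countable set of ordinals", there are a $\mathbb P(T)$-name $\dot h$ and a name $\dot y$ for Cohen forcing $\mathrm{Fn}(\omega,2)$ (the finite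 partial functions from $\omega$ to $2$, ordered by reverse inclusion) such that $\dot h$ is forced by every condition to be a filter on $\mathrm{Fn}(\omega,2)$ that is generic over the ground model $V$, and $p$ forces $\dot x=\dot y[\dot h]$, so that $p$ forces $\dot x\in V[\dot h]$. -/

import Mathlib

universe u v w

/-! ### Set-theoretic trees -/

namespace SetTree

/-- A tree: a partial order in which the strict predecessors of every node are well ordered. -/
class IsTree (T : Type u) [PartialOrder T] : Prop where
  isWellOrder_Iio : ∀ t : T, IsWellOrder (Set.Iio t) (· < ·)

instance (T : Type u) [PartialOrder T] [IsTree T] (t : T) : IsWellOrder (Set.Iio t) (· < ·) :=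
  IsTree.isWellOrder_Iio t

/-- `level T α` is the set of nodes whose set of strict predecessors has order type `α`. -/
def level (T : Type u) [PartialOrder T] [IsTree T] (α : Ordinal.{u}) : Set T :=
  {t | Ordinal.type (fun a b : Set.Iio t => a < b) = α}

/-- `T` has height `η`: `η` is the least ordinal whose level is empty. -/
def HasHeight (T : Type u) [PartialOrder T] [IsTree T] (η : Ordinal.{u}) : Prop :=
  IsLeast {α | level T α = ∅} η

/-- There is a unique minimal node. -/
def IsRooted (T : Type u) [PartialOrder T] : Prop :=
  ∃! r : T, IsMin r

/-- A tree of height `η` is normal if every node is comparable with a node of every level below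
`η`, and distinct nodes of the same limit level have distinct sets of predecessors. -/
structure IsNormal (T : Type u) [PartialOrder T] [IsTree T] (η : Ordinal.{u}) : Prop where
  comparable : ∀ t : T, ∀ α < η, ∃ s ∈ level T α, s ≤ t ∨ t ≤ s
  limit_unique : ∀ δ : Ordinal.{u}, Order.IsSuccLimit δ → ∀ s ∈ level T δ, ∀ t ∈ level T δ,
    Set.Iio s = Set.Iio t → s = t

/-- A generalized Aronszajn tree: a (normal, rooted) tree of height `ω₁` without uncountable
branches, a branch being a maximal linearly ordered subset. -/
structure IsGenAronszajn (T : Type u) [PartialOrder T] [IsTree T] : Prop where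
  height : HasHeight T (Ordinal.omega 1)
  normal : IsNormal T (Ordinal.omega 1)
  rooted : IsRooted T
  branch_countable : ∀ b : Set T, IsMaxChain (· ≤ ·) b → b.Countable

/-- All levels are countable. -/
def HasCountableLevels (T : Type u) [PartialOrder T] [IsTree T] : Prop :=
  ∀ α : Ordinal.{u}, (level T α).Countable

end SetTree

/-! ### Forcing: names, the forcing relation -/

namespace Forcing

/-- `P`-names: a name is a (small) family of pairs consisting of a condition and a name. -/
inductive PName (P : Type v) : Type (max (u + 1) v)
  | mk (ι : Type u) (cond : ι → P) (elt : ι → PName P) : PName P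

/-- A sentence of the forcing language, given by the set of conditions that force it. -/
abbrev Sentence (P : Type v) := P → Prop

/-- The forcing relation `p ⊩ φ`. -/
def Forces {P : Type v} (p : P) (φ : Sentence P) : Prop := φ p

infix:20 " ⊩ " => Forces

section Language

variable {P : Type v} [Preorder P]

/-! Stronger conditions are smaller. The clauses are the usual recursive clauses for forcing. -/

/-- Conjunction. -/
def Sentence.and (φ ψ : Sentence P) : Sentence P := fun p => (p ⊩ φ) ∧ (p ⊩ ψ)

/-- Implication. -/
def Sentence.imp (φ ψ : Sentence P) : Sentence P := fun p => ∀ q ≤ p, (q ⊩ φ) → (q ⊩ ψ)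

/-- Universal quantification, over all names or over a ground model set. -/
def Sentence.all {X : Sort w} (φ : X → Sentence P) : Sentence P := fun p => ∀ x, p ⊩ φ x

/-- Existential quantification, over all names or over a ground model set. -/
def Sentence.ex {X : Sort w} (φ : X → Sentence P) : Sentence P :=
  fun p => ∀ q ≤ p, ∃ r ≤ q, ∃ x, r ⊩ φ x

infixr:35 " ⋏ " => Sentence.and
infixr:25 " ⇛ " => Sentence.imp

/-- `p ⊩ x = y`: below `p`, every element of `x` is forced to be an element of `y`, and
conversely. -/
def PName.eq : PName.{u, v} P → PName.{u, v} P → Sentence P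
  | .mk ι c x, .mk κ d y => fun p =>
    (∀ i : ι, ∀ q ≤ p, q ≤ c i → ∃ r ≤ q, ∃ j : κ, r ≤ d j ∧ PName.eq (x i) (y j) r) ∧
    (∀ j : κ, ∀ q ≤ p, q ≤ d j → ∃ r ≤ q, ∃ i : ι, r ≤ c i ∧ PName.eq (x i) (y j) r)

/-- `p ⊩ x ∈ y`: densely many `r` below `p` lie below a condition `d j` of the name `y` and force
`x` to be equal to the corresponding element `y j`. -/
def PName.mem (x : PName.{u, v} P) : PName.{u, v} P → Sentence P
  | .mk κ d y => fun p => ∀ q ≤ p, ∃ r ≤ q, ∃ j : κ, r ≤ d j ∧ (r ⊩ PName.eq x (y j))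

infix:50 " ≐ " => PName.eq
infix:50 " ∊ " => PName.mem

/-- The sentence "`x` is a transitive set". -/
def isTransitive (x : PName.{u, v} P) : Sentence P :=
  .all fun y : PName.{u, v} P => .all fun z : PName.{u, v} P => y ∊ x ⇛ z ∊ y ⇛ z ∊ x

/-- The sentence "`x` is an ordinal", that is, a transitive set of transitive sets. -/
def isOrdinal (x : PName.{u, v} P) : Sentence P :=
  isTransitive x ⋏ .all fun y : PName.{u, v} P => y ∊ x ⇛ isTransitive y

/-- The sentence "`x` is a set of ordinals". -/
def isSetOfOrdinals (x : PName.{u, v} P) : Sentence P :=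
  .all fun y : PName.{u, v} P => y ∊ x ⇛ isOrdinal y

variable [OrderTop P]

/-- The canonical name `x̌` of a ground model set. -/
def check : PSet.{u} → PName.{u, v} P
  | .mk ι x => .mk ι (fun _ => ⊤) (fun i => check (x i))

/-- The canonical name of the unordered pair `{x, y}`. -/
def upair (x y : PName.{u, v} P) : PName.{u, v} P :=
  .mk (ULift Bool) (fun _ => ⊤) (fun b => if b.down then x else y)

/-- The canonical name of the (Kuratowski) ordered pair `(x, y) = {{x}, {x, y}}`. -/
def opair (x y : PName.{u, v} P) : PName.{u, v} P :=
  upair (upair x x) (upair x y)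

/-- The sentence "`x` is countable": there is an injective function from `x` to `ω`. -/
def isCountable (x : PName.{u, v} P) : Sentence P :=
  .ex fun f : PName.{u, v} P =>
    (.all fun y : PName.{u, v} P => y ∊ x ⇛
      .ex fun n : PName.{u, v} P => n ∊ check PSet.omega ⋏ opair y n ∊ f) ⋏
    (.all fun y : PName.{u, v} P => .all fun m : PName.{u, v} P => .all fun n : PName.{u, v} P =>
      opair y m ∊ f ⇛ opair y n ∊ f ⇛ m ≐ n) ⋏
    (.all fun y : PName.{u, v} P => .all fun z : PName.{u, v} P => .all fun n : PName.{u, v} P =>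
      opair y n ∊ f ⇛ opair z n ∊ f ⇛ y ≐ z)

end Language

/-! ### Generic filters of another forcing notion in a forcing extension, and the extension they
generate -/

/-- A `P`-name for a subset of the ground model set `C`: the name consisting of all pairs
`(č, p)` with `p ∈ h c`. -/
abbrev SubsetName (C : Type w) (P : Type v) := C → Set P

section Subextension

variable {C : Type w} [Preorder C] {P : Type u} [Preorder P]

/-- The sentence "`c ∈ h`". -/
def SubsetName.has (h : SubsetName C P) (c : C) : Sentence P :=
  fun p => ∀ q ≤ p, ∃ r ≤ q, ∃ s ∈ h c, r ≤ s

/-- The sentence "`h` is a filter on `C` which is generic over the ground model": it is upward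
closed, any two elements have a common extension in it, and it meets every dense subset of `C` of
the ground model (in particular the whole of `C`). -/
def SubsetName.isGeneric (h : SubsetName C P) : Sentence P :=
  (.all fun c : C => .all fun d : {d : C // c ≤ d} => h.has c ⇛ h.has d) ⋏
  (.all fun c : C => .all fun d : C => h.has c ⋏ h.has d ⇛
    .ex fun e : {e : C // e ≤ c ∧ e ≤ d} => h.has e) ⋏
  (.all fun D : {D : Set C // ∀ c, ∃ d ∈ D, d ≤ c} => .ex fun c : D.1 => h.has c)

/-- The `P`-name for the evaluation `y[h]` of the `C`-name `y` by (the interpretation of) `h`,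
that is, for the set of all `z[h]` with `(c, z) ∈ y` for some `c ∈ h`. If `h` is forced to be a
generic filter, the sets of this form are the elements of the subextension `V[h]`. -/
def PName.evalBy (h : SubsetName C P) : PName.{u, w} C → PName.{u, u} P
  | .mk ι c y => .mk (Σ i : ι, h (c i)) (fun a => a.2) (fun a => PName.evalBy h (y a.1))

end Subextension

/-! ### Cohen forcing and the specializing forcing -/

/-- Finite partial functions from `X` to `Y`. -/
structure FinPFun (X : Type v) (Y : Type w) where
  toFun : X → Option Y
  finite_dom : {x | toFun x ≠ none}.Finite

/-- Finite partial functions are ordered by reverse inclusion (of graphs). -/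
instance (X : Type v) (Y : Type w) : PartialOrder (FinPFun X Y) where
  le p q := ∀ x y, q.toFun x = some y → p.toFun x = some y
  le_refl _ _ _ h := h
  le_trans _ _ _ h₁ h₂ x y h := h₁ x y (h₂ x y h)
  le_antisymm p q h₁ h₂ := by
    obtain ⟨f, hf⟩ := p
    obtain ⟨g, hg⟩ := q
    have : f = g := funext fun x => Option.ext fun y => ⟨h₂ x y, h₁ x y⟩
    subst this
    rfl

/-- The empty function is the weakest condition. -/
instance (X : Type v) (Y : Type w) : OrderTop (FinPFun X Y) where
  top := ⟨fun _ => none, by simp⟩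
  le_top _ _ _ h := by cases h

/-- Cohen forcing: finite partial functions from `ω` to `2`. -/
abbrev Cohen := FinPFun ℕ Bool

/-- The forcing `ℙ(T)` specializing `T`: finite partial functions `p : T → ω` which are injective
on chains, ordered by reverse inclusion. -/
abbrev Specializing (T : Type u) [PartialOrder T] :=
  {p : FinPFun T ℕ // ∀ s t : T, s < t → ∀ m n : ℕ,
    p.toFun s = some m → p.toFun t = some n → m ≠ n}

instance (T : Type u) [PartialOrder T] : OrderTop (Specializing T) where
  top := ⟨⊤, by intro s t _ m n h; cases h⟩
  le_top p := le_top (a := p.1)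

end Forcing

/-! Specializing a tree without uncountable chains is ccc (`Specializing.ccc`). Hence a countable
set of ordinals $\dot x$ of the extension is covered by a countable ground model set $\{a_n\}$, and
for each $n$ a countable set $D_n$ of conditions, predense among those forcing $a_n\in\dot x$,
captures the membership of $a_n$. The countably many domains involved lie below a single level
$\delta<\omega_1$, so the part of the generic specializing function below $\delta$ already
determines $\dot x$.

It remains to see that this part is contained in a Cohen extension. Restricting conditions to the
nodes below $\delta$ is not a projection: a node above level $\delta$ coloured $n$ forbids $n$ on
all its predecessors, and the restriction forgets this. The `trace` therefore also records, at each
node of height $\delta$, the colours used at or above it. With this extra information the map is a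
projection (`isProjection_toTrace`): a missing colour at height $\delta$ can be placed on a fresh
node above, and a clash there would be visible as a clash inside the target condition.

As levels are countable and traces finite, the traces form a countable forcing notion, which is
atomless once $\delta\ge\omega$. Such a forcing has a dense copy of $\omega^{<\omega}$
(`Atomless.exists_isDenseTree`), and so does Cohen forcing. Matching the two copies carries the
induced generic filter to a Cohen generic one, from which $\dot x$ is read off. -/

namespace Forcing

/-! ### Equality and membership of names -/

section Basic

variable {P : Type v} [Preorder P]

namespace PName

theorem eq_mk_iff {p : P} {ι κ : Type u} {c : ι → P} {x : ι → PName.{u, v} P} {d : κ → P}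
    {y : κ → PName.{u, v} P} :
    (p ⊩ PName.mk ι c x ≐ PName.mk κ d y) ↔
      (∀ i : ι, ∀ q ≤ p, q ≤ c i → ∃ r ≤ q, ∃ j : κ, r ≤ d j ∧ (r ⊩ x i ≐ y j)) ∧
      (∀ j : κ, ∀ q ≤ p, q ≤ d j → ∃ r ≤ q, ∃ i : ι, r ≤ c i ∧ (r ⊩ x i ≐ y j)) := by
  simp only [Forces, PName.eq]

theorem mem_mk_iff {p : P} {κ : Type u} {x : PName.{u, v} P} {d : κ → P}
    {y : κ → PName.{u, v} P} :
    (p ⊩ x ∊ PName.mk κ d y) ↔ ∀ q ≤ p, ∃ r ≤ q, ∃ j : κ, r ≤ d j ∧ (r ⊩ x ≐ y j) :=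
  Iff.rfl

theorem eq_mono {x y : PName.{u, v} P} {p q : P} (hq : q ≤ p) (h : p ⊩ x ≐ y) : q ⊩ x ≐ y := by
  cases x; cases y
  rw [eq_mk_iff] at h ⊢
  exact ⟨fun i r hr => h.1 i r (hr.trans hq), fun j r hr => h.2 j r (hr.trans hq)⟩

theorem eq_refl (x : PName.{u, v} P) (p : P) : p ⊩ x ≐ x := by
  induction x generalizing p with
  | mk ι c x ih =>
    rw [eq_mk_iff]
    exact ⟨fun i q _ hi => ⟨q, le_rfl, i, hi, ih i q⟩, fun i q _ hi => ⟨q, le_rfl, i, hi, ih i q⟩⟩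

theorem eq_symm {x y : PName.{u, v} P} {p : P} (h : p ⊩ x ≐ y) : p ⊩ y ≐ x := by
  induction x generalizing y p with
  | mk ι c x ih =>
    cases y
    rw [eq_mk_iff] at h ⊢
    refine ⟨fun j q hq hj => ?_, fun i q hq hi => ?_⟩
    · obtain ⟨r, hr, i, hi, e⟩ := h.2 j q hq hj
      exact ⟨r, hr, i, hi, ih i e⟩
    · obtain ⟨r, hr, j, hj, e⟩ := h.1 i q hq hi
      exact ⟨r, hr, j, hj, ih i e⟩

theorem eq_trans {x y z : PName.{u, v} P} {p : P} (h : p ⊩ x ≐ y) (h' : p ⊩ y ≐ z) :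
    p ⊩ x ≐ z := by
  induction x generalizing y z p with
  | mk ι c x ih =>
    cases y; cases z
    rw [eq_mk_iff] at h h' ⊢
    refine ⟨fun i q hq hi => ?_, fun k q hq hk => ?_⟩
    · obtain ⟨r, hr, j, hj, e⟩ := h.1 i q hq hi
      obtain ⟨s, hs, k, hk, e'⟩ := h'.1 j r (hr.trans hq) hj
      exact ⟨s, hs.trans hr, k, hk, ih i (eq_mono hs e) e'⟩
    · obtain ⟨r, hr, j, hj, e⟩ := h'.2 k q hq hk
      obtain ⟨s, hs, i, hi, e'⟩ := h.2 j r (hr.trans hq) hj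
      exact ⟨s, hs.trans hr, i, hi, ih i e' (eq_mono hs e)⟩

theorem mem_mono {x y : PName.{u, v} P} {p q : P} (hq : q ≤ p) (h : p ⊩ x ∊ y) : q ⊩ x ∊ y := by
  cases y
  exact fun r hr => h r (hr.trans hq)

theorem mem_of_dense {x y : PName.{u, v} P} {p : P} (h : ∀ q ≤ p, ∃ r ≤ q, r ⊩ x ∊ y) :
    p ⊩ x ∊ y := by
  cases y
  intro q hq
  obtain ⟨r, hr, hm⟩ := h q hq
  obtain ⟨s, hs, hj⟩ := hm r le_rfl
  exact ⟨s, hs.trans hr, hj⟩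

theorem mem_congr_left {x x' y : PName.{u, v} P} {p : P} (h : p ⊩ x ≐ x') (hm : p ⊩ x ∊ y) :
    p ⊩ x' ∊ y := by
  cases y
  intro q hq
  obtain ⟨r, hr, j, hj, e⟩ := hm q hq
  exact ⟨r, hr, j, hj, eq_trans (eq_symm (eq_mono (hr.trans hq) h)) e⟩

theorem mem_congr_right {x y y' : PName.{u, v} P} {p : P} (h : p ⊩ y ≐ y') (hm : p ⊩ x ∊ y) :
    p ⊩ x ∊ y' := by
  cases y; cases y'
  rw [eq_mk_iff] at h
  intro q hq
  obtain ⟨r, hr, j, hj, e⟩ := hm q hq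
  obtain ⟨s, hs, k, hk, e'⟩ := h.1 j r (hr.trans hq) hj
  exact ⟨s, hs.trans hr, k, hk, eq_trans (eq_mono hs e) e'⟩

theorem elt_mem {ι : Type u} {c : ι → P} {x : ι → PName.{u, v} P} {i : ι} {p : P} (h : p ≤ c i) :
    p ⊩ x i ∊ PName.mk ι c x :=
  fun q hq => ⟨q, le_rfl, i, hq.trans h, eq_refl _ _⟩

end PName

open PName

theorem isTransitive_mono {x : PName.{u, v} P} {p q : P} (hq : q ≤ p) (h : p ⊩ isTransitive x) :
    q ⊩ isTransitive x :=
  fun y z r hr => h y z r (hr.trans hq)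

theorem isOrdinal_mono {x : PName.{u, v} P} {p q : P} (hq : q ≤ p) (h : p ⊩ isOrdinal x) :
    q ⊩ isOrdinal x :=
  ⟨isTransitive_mono hq h.1, fun y r hr => h.2 y r (hr.trans hq)⟩

/-- Elements of ordinals are ordinals. -/
theorem isOrdinal_of_mem {x y : PName.{u, v} P} {p : P} (h : p ⊩ isOrdinal x) (hm : p ⊩ y ∊ x) :
    p ⊩ isOrdinal y := by
  refine ⟨h.2 y p le_rfl hm, fun z q hq hz => ?_⟩
  exact h.2 z q hq (h.1 y z q hq (mem_mono hq hm) q le_rfl hz)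

end Basic

section Top

variable {P : Type v} [Preorder P] [OrderTop P]

open PName

theorem upair_congr {x x' y y' : PName.{u, v} P} {p : P} (hx : p ⊩ x ≐ x') (hy : p ⊩ y ≐ y') :
    p ⊩ upair x y ≐ upair x' y' := by
  have key : ∀ b : Bool, p ⊩ (if b then x else y) ≐ (if b then x' else y') := by
    rintro (_ | _)
    · simpa using hy
    · simpa using hx
  unfold upair
  rw [eq_mk_iff]
  exact ⟨fun b q hq _ => ⟨q, le_rfl, b, le_top, eq_mono hq (key b.down)⟩,
    fun b q hq _ => ⟨q, le_rfl, b, le_top, eq_mono hq (key b.down)⟩⟩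

theorem opair_congr {x x' y y' : PName.{u, v} P} {p : P} (hx : p ⊩ x ≐ x') (hy : p ⊩ y ≐ y') :
    p ⊩ opair x y ≐ opair x' y' :=
  upair_congr (upair_congr hx hx) (upair_congr hx hy)

/-- Elements of `ω` are decided on a dense set. -/
theorem exists_eq_ofNat_of_mem_omega {x : PName.{u, v} P} {p : P}
    (h : p ⊩ x ∊ check PSet.omega) :
    ∃ r ≤ p, ∃ n : ℕ, r ⊩ x ≐ check (PSet.ofNat.{u} n) := by
  unfold PSet.omega at h
  simp only [check] at h
  obtain ⟨r, hr, j, -, e⟩ := h p le_rfl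
  exact ⟨r, hr, j.down, e⟩

/-! ### Canonical names of ordinals -/

/-- The canonical name of the von Neumann ordinal `α`. -/
noncomputable def ordName (P : Type v) [Preorder P] [OrderTop P] (α : Ordinal.{u}) :
    PName.{u, v} P :=
  .mk α.ToType (fun _ => ⊤) (fun i => ordName P i.toOrd.1)
termination_by α
decreasing_by exact i.toOrd.2

theorem mem_ordName_iff {x : PName.{u, v} P} {α : Ordinal.{u}} {p : P} :
    (p ⊩ x ∊ ordName P α) ↔ ∀ q ≤ p, ∃ r ≤ q, ∃ β < α, r ⊩ x ≐ ordName P β := by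
  rw [ordName, mem_mk_iff]
  refine forall₂_congr fun q _ => exists_congr fun r => and_congr_right fun _ => ?_
  constructor
  · rintro ⟨j, -, e⟩
    exact ⟨_, j.toOrd.2, e⟩
  · rintro ⟨β, hβ, e⟩
    refine ⟨Ordinal.ToType.mk ⟨β, hβ⟩, le_top, ?_⟩
    simpa using e

theorem ordName_mem {α β : Ordinal.{u}} (h : α < β) (p : P) : p ⊩ ordName P α ∊ ordName P β :=
  mem_ordName_iff.2 fun q _ => ⟨q, le_rfl, α, h, eq_refl _ _⟩

/-- Infinite descent: an equality of `α` with a smaller `β` puts `β` into itself, and so makes `β`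
equal to some smaller `γ`. -/
theorem not_ordName_eq_of_lt {α β : Ordinal.{u}} (h : β < α) (p : P) :
    ¬ (p ⊩ ordName P α ≐ ordName P β) := by
  induction α using WellFoundedLT.induction generalizing β p with
  | ind α ih =>
    intro e
    have hm := mem_congr_right e (ordName_mem h p)
    obtain ⟨r, -, γ, hγ, e'⟩ := mem_ordName_iff.1 hm p le_rfl
    exact ih β h hγ r e'

theorem ordName_inj {α β : Ordinal.{u}} {p : P} (h : p ⊩ ordName P α ≐ ordName P β) : α = β := by
  rcases lt_trichotomy α β with hl | he | hl
  · exact absurd (eq_symm h) (not_ordName_eq_of_lt hl p)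
  · exact he
  · exact absurd h (not_ordName_eq_of_lt hl p)

end Top

section Decide

variable {P : Type u} [Preorder P] [OrderTop P]

open PName

/-- A name forced to be an ordinal is decided by a dense set of conditions. -/
theorem exists_eq_ordName {x : PName.{u, u} P} {p : P} (h : p ⊩ isOrdinal x) :
    ∃ r ≤ p, ∃ α : Ordinal.{u}, r ⊩ x ≐ ordName P α := by
  classical
  induction x generalizing p with
  | mk ι c x ih =>
    set X := PName.mk ι c x with hX
    -- The range of `f` contains every ordinal that some condition forces some `x i` to equal; `0`
    -- is a dummy value. A bound `b` exists because the range is small.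
    let f : ι × P → Ordinal.{u} := fun a =>
      if h : ∃ α : Ordinal.{u}, a.2 ⊩ x a.1 ≐ ordName P α then h.choose else 0
    obtain ⟨b, hb⟩ := Ordinal.bddAbove_of_small (s := Set.range f)
    have hf : ∀ (i : ι) (r : P) (α : Ordinal.{u}), (r ⊩ x i ≐ ordName P α) → α ≤ b := by
      intro i r α e
      have h : ∃ α : Ordinal.{u}, r ⊩ x i ≐ ordName P α := ⟨α, e⟩
      have h1 : f (i, r) = h.choose := dif_pos h
      have h2 : α = f (i, r) := h1 ▸ ordName_inj (eq_trans (eq_symm e) h.choose_spec)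
      exact h2 ▸ hb ⟨_, rfl⟩
    -- The least `β` that some `q ≤ p` forces out of `X` is the value of `X` at `q`: minimality puts
    -- all smaller ordinals into `X`, and transitivity of `X` keeps out all larger ones.
    let S : Set Ordinal.{u} := {β | ∃ q ≤ p, ∀ r ≤ q, ¬ (r ⊩ ordName P β ∊ X)}
    have hS : S.Nonempty := by
      refine ⟨Order.succ b, p, le_rfl, fun r _ hr => ?_⟩
      obtain ⟨s, -, i, -, e⟩ := hr r le_rfl
      exact absurd (hf i s _ (eq_symm e)) (not_le.2 (Order.lt_succ b))
    obtain ⟨β, ⟨q, hq, hβ⟩, hmin⟩ := WellFounded.has_min wellFounded_lt S hS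
    have hlow : ∀ γ < β, q ⊩ ordName P γ ∊ X := by
      intro γ hγ
      refine mem_of_dense fun r hr => ?_
      by_contra hcon
      push Not at hcon
      exact hmin γ ⟨r, hr.trans hq, hcon⟩ hγ
    refine ⟨q, hq, β, ?_⟩
    rw [ordName, hX, eq_mk_iff]
    constructor
    · intro i r hr hi
      have hm : r ⊩ x i ∊ X := elt_mem hi
      obtain ⟨s, hs, α, e⟩ := ih i (isOrdinal_of_mem (isOrdinal_mono (hr.trans hq) h) hm)
      have hα : α < β := by
        by_contra hcon
        have hm' : s ⊩ ordName P α ∊ X := mem_congr_left e (mem_mono hs hm)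
        refine hβ s (hs.trans hr) ?_
        rcases (not_lt.1 hcon).eq_or_lt with rfl | hlt
        · exact hm'
        · exact h.1 _ _ s (hs.trans (hr.trans hq)) hm' s le_rfl (ordName_mem hlt s)
      refine ⟨s, hs, Ordinal.ToType.mk ⟨α, hα⟩, le_top, ?_⟩
      simpa using e
    · intro j r hr _
      obtain ⟨s, hs, i, hi, e⟩ := hlow j.toOrd.1 j.toOrd.2 r hr
      exact ⟨s, hs, i, hi, eq_symm e⟩

end Decide

section Eval

variable {P : Type u} [Preorder P] [OrderTop P] {C : Type w} [Preorder C] [OrderTop C]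

open PName

/-- Names of ordinals are evaluated to the ordinals that they name. -/
theorem evalBy_ordName_eq {h : SubsetName C P} (htop : ∀ p, p ⊩ h.has ⊤) (α : Ordinal.{u})
    (p : P) : p ⊩ ordName P α ≐ (ordName C α).evalBy h := by
  induction α using WellFoundedLT.induction generalizing p with
  | ind α ih =>
    rw [ordName, ordName, evalBy, eq_mk_iff]
    constructor
    · intro i q _ _
      obtain ⟨r, hr, s, hs, hrs⟩ := htop q q le_rfl
      exact ⟨r, hr, ⟨i, s, hs⟩, hrs, ih _ i.toOrd.2 r⟩
    · rintro ⟨i, s⟩ q _ _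
      exact ⟨q, le_rfl, i, le_top, ih _ i.toOrd.2 q⟩

end Eval

/-! ### Antichains -/

section Antichain

variable {P : Type v} [Preorder P]

/-- Two conditions are compatible if they have a common extension. -/
def Compat (p q : P) : Prop := ∃ r, r ≤ p ∧ r ≤ q

theorem Compat.symm {p q : P} (h : Compat p q) : Compat q p :=
  let ⟨r, h₁, h₂⟩ := h; ⟨r, h₂, h₁⟩

theorem Compat.mono {p q p' q' : P} (h : Compat p q) (hp : p ≤ p') (hq : q ≤ q') :
    Compat p' q' :=
  let ⟨r, h₁, h₂⟩ := h; ⟨r, h₁.trans hp, h₂.trans hq⟩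

theorem Compat.of_le {p q : P} (h : p ≤ q) : Compat p q := ⟨p, le_rfl, h⟩

/-- The countable chain condition. -/
def CCC (P : Type v) [Preorder P] : Prop :=
  ∀ A : Set P, A.Pairwise (fun p q => ¬ Compat p q) → A.Countable

/-- Every antichain in `D` extends to a maximal one. -/
theorem exists_maximal_antichain {D A₀ : Set P} (hA₀ : A₀ ⊆ D)
    (hanti : A₀.Pairwise (fun p q => ¬ Compat p q)) :
    ∃ A, A₀ ⊆ A ∧ A ⊆ D ∧ A.Pairwise (fun p q => ¬ Compat p q) ∧
      ∀ d ∈ D, ∃ a ∈ A, Compat d a := by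
  obtain ⟨A, hA, hmax⟩ := zorn_subset_nonempty
    {A : Set P | A ⊆ D ∧ A.Pairwise (fun p q => ¬ Compat p q)} (by
      intro c hc hchain _
      refine ⟨⋃₀ c, ⟨Set.sUnion_subset fun s hs => (hc hs).1, ?_⟩,
        fun s hs => Set.subset_sUnion_of_mem hs⟩
      exact (Set.pairwise_sUnion hchain.directedOn).2 fun s hs => (hc hs).2) A₀ ⟨hA₀, hanti⟩
  refine ⟨A, hA, hmax.prop.1, hmax.prop.2, fun d hd => ?_⟩
  by_contra hcon
  push Not at hcon
  have hins : insert d A ⊆ A := hmax.le_of_ge (y := insert d A)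
    ⟨Set.insert_subset hd hmax.prop.1, hmax.prop.2.insert fun a ha _ =>
      ⟨hcon a ha, fun h => hcon a ha h.symm⟩⟩ (Set.subset_insert d A)
  exact hcon d (hins (Set.mem_insert d A)) (Compat.of_le le_rfl)

/-- Under the countable chain condition, every set of conditions has a countable subset that is
predense in it. -/
theorem CCC.exists_countable_predense (hP : CCC P) (D : Set P) :
    ∃ D' ⊆ D, D'.Countable ∧ ∀ d ∈ D, ∃ d' ∈ D', Compat d d' := by
  obtain ⟨A, -, hAD, hA, hmax⟩ := exists_maximal_antichain (Set.empty_subset D)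
    (Set.pairwise_empty _)
  exact ⟨A, hAD, hP A hA, hmax⟩

end Antichain

/-! ### Covering countable sets of ordinals under the countable chain condition -/

section Countable

variable {P : Type u} [Preorder P] [OrderTop P]

open PName

/-- Under the countable chain condition, a name takes only countably many ordinal values. -/
theorem CCC.countable_values (hP : CCC P) (φ : Ordinal.{u} → Sentence P)
    (hmono : ∀ α p, (p ⊩ φ α) → ∀ q ≤ p, q ⊩ φ α)
    (q : P) (hφ : ∀ α β, ∀ r ≤ q, (r ⊩ φ α) → (r ⊩ φ β) → α = β) :
    {α | ∃ r ≤ q, r ⊩ φ α}.Countable := by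
  set S := {α | ∃ r ≤ q, r ⊩ φ α}
  choose! g hg using fun (α : Ordinal.{u}) (hα : α ∈ S) => hα
  have key : ∀ α ∈ S, ∀ β ∈ S, Compat (g α) (g β) → α = β := by
    rintro α hα β hβ ⟨r, h₁, h₂⟩
    exact hφ α β r (h₁.trans (hg α hα).1) (hmono α _ (hg α hα).2 r h₁)
      (hmono β _ (hg β hβ).2 r h₂)
  have hinj : Set.InjOn g S := fun α hα β hβ e => key α hα β hβ (e ▸ Compat.of_le le_rfl)
  refine Set.countable_of_injective_of_countable_image hinj (hP _ ?_)
  rintro _ ⟨α, hα, rfl⟩ _ ⟨β, hβ, rfl⟩ hne hc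
  exact hne (congrArg g (key α hα β hβ hc))

/-- Under the countable chain condition, a countable set of ordinals of the extension is covered
by a countable set of the ground model. -/
theorem CCC.countable_ordinals (hP : CCC P) {p : P} {x : PName.{u, u} P}
    (hx : p ⊩ isCountable x) : {α : Ordinal.{u} | ∃ r ≤ p, r ⊩ ordName P α ∊ x}.Countable := by
  -- Conditions with only countably many candidates below them turn out to be dense below `p`, so a
  -- countable predense family of them accounts for all candidates below `p`.
  obtain ⟨D, hD, hDc, hpre⟩ := hP.exists_countable_predense
    {q : P | {α : Ordinal.{u} | ∃ r ≤ q, r ⊩ ordName P α ∊ x}.Countable}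
  refine (hDc.biUnion fun q hq => hD hq).mono ?_
  rintro α ⟨r, hr, hα⟩
  suffices h : ∃ s ≤ r, {α : Ordinal.{u} | ∃ r ≤ s, r ⊩ ordName P α ∊ x}.Countable by
    obtain ⟨s, hs, hsc⟩ := h
    obtain ⟨d, hd, t, ht, htd⟩ := hpre s hsc
    exact Set.mem_biUnion hd ⟨t, htd, mem_mono (ht.trans hs) hα⟩
  obtain ⟨s, hs, f, htot, -, hinj⟩ := hx r hr
  refine ⟨s, hs, ?_⟩
  -- Once the injection `f` is fixed, sort the candidates by the number `n` that `f` may assign to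
  -- them; injectivity makes those with the same `n` the possible values of a single ordinal.
  refine Set.Countable.mono ?_ (Set.countable_iUnion fun n : ℕ =>
    hP.countable_values (fun β => opair (ordName P β) (check (PSet.ofNat.{u} n)) ∊ f)
      (fun β p h q hq => mem_mono hq h) s
      (fun β γ t ht h₁ h₂ => ordName_inj (hinj _ _ _ t ht h₁ t le_rfl h₂)))
  rintro β ⟨t, ht, hβ⟩
  obtain ⟨t', ht', m, hm, hf⟩ := htot _ t ht hβ t le_rfl
  obtain ⟨t'', ht'', n, e⟩ := exists_eq_ofNat_of_mem_omega hm
  refine Set.mem_iUnion.2 ⟨n, t'', ht''.trans (ht'.trans ht), ?_⟩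
  exact mem_congr_left (opair_congr (eq_refl _ _) e) (mem_mono ht'' hf)

end Countable

/-! ### Dense trees in countable atomless forcing notions -/

section DenseTree

variable {Q : Type w} [Preorder Q]

/-- Every condition has two incompatible extensions. -/
def Atomless (Q : Type w) [Preorder Q] : Prop :=
  ∀ q : Q, ∃ a ≤ q, ∃ b ≤ q, ¬ Compat a b

/-- A copy of the tree of finite sequences of natural numbers (with the last entry at the head)
which is dense in `Q` and in which incomparable sequences yield incompatible conditions. -/
structure IsDenseTree (e : List ℕ → Q) : Prop where
  cons_le : ∀ k s, e (k :: s) ≤ e s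
  incompat : ∀ j k s, j ≠ k → ¬ Compat (e (j :: s)) (e (k :: s))
  dense : ∀ q, ∃ s, e s ≤ q

namespace IsDenseTree

variable {e : List ℕ → Q}

theorem le_of_suffix (he : IsDenseTree e) {s t : List ℕ} (h : s <:+ t) : e t ≤ e s := by
  obtain ⟨u, rfl⟩ := h
  induction u with
  | nil => exact le_rfl
  | cons k u ih => exact (he.cons_le k _).trans ih

theorem eq_of_compat (he : IsDenseTree e) {s t : List ℕ} (hl : s.length = t.length)
    (h : Compat (e s) (e t)) : s = t := by
  induction s generalizing t with
  | nil => exact (List.length_eq_zero_iff.1 hl.symm).symm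
  | cons j s ih =>
    cases t with
    | nil => simp at hl
    | cons k t =>
      obtain rfl := ih (by simpa using hl) (h.mono (he.cons_le _ _) (he.cons_le _ _))
      by_contra hne
      exact he.incompat j k s (fun hjk => hne (by rw [hjk])) h

theorem suffix_of_compat_of_length_le (he : IsDenseTree e) {s t : List ℕ} (hl : s.length ≤ t.length)
    (h : Compat (e s) (e t)) : s <:+ t := by
  have hd : t.drop (t.length - s.length) <:+ t := List.drop_suffix _ _
  have : s = t.drop (t.length - s.length) :=
    he.eq_of_compat (by simp; omega) (h.mono le_rfl (he.le_of_suffix hd))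
  rwa [← this] at hd

theorem suffix_or_suffix (he : IsDenseTree e) {s t : List ℕ} (h : Compat (e s) (e t)) :
    s <:+ t ∨ t <:+ s := by
  rcases le_total s.length t.length with hl | hl
  · exact Or.inl (he.suffix_of_compat_of_length_le hl h)
  · exact Or.inr (he.suffix_of_compat_of_length_le hl h.symm)

/-- Together with `le_of_suffix`, this makes the order on the tree exactly the suffix order, so two
dense trees can be matched node by node. -/
theorem suffix_of_le (he : IsDenseTree e) {s t : List ℕ} (h : e t ≤ e s) : s <:+ t := by
  rcases he.suffix_or_suffix (Compat.of_le h) with hs | hs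
  · cases s with
    | nil => exact List.nil_suffix
    | cons k s =>
      rcases List.suffix_cons_iff.1 hs with rfl | hs
      · exact List.suffix_rfl
      · refine absurd ?_ (he.incompat (k + 1) k s (by omega))
        exact Compat.of_le ((he.cons_le _ _).trans ((he.le_of_suffix hs).trans h))
  · exact hs

end IsDenseTree

/-- Below every condition of an atomless forcing notion, every dense set contains an infinite
antichain. -/
theorem Atomless.exists_infinite_antichain (hQ : Atomless Q) (q : Q) {D : Set Q}
    (hD : ∀ r ≤ q, ∃ d ∈ D, d ≤ r) :
    ∃ A ⊆ D, A.Infinite ∧ A.Pairwise (fun a b => ¬ Compat a b) := by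
  choose a ha b hb hab using hQ
  -- Descend along the branch `a` and leave it through `b` at every stage: all later members are
  -- below `a (c m)`, which is incompatible with `b (c m)`.
  let c : ℕ → Q := fun n => a^[n] q
  have hc : Antitone c := antitone_nat_of_succ_le fun n => by
    simp only [c, Function.iterate_succ_apply']
    exact ha _
  have hcq : ∀ n, c n ≤ q := fun n => hc (Nat.zero_le n)
  choose d hdD hd using fun n => hD (b (c n)) ((hb _).trans (hcq n))
  have hlt : ∀ m n, m < n → ¬ Compat (d m) (d n) := by
    intro m n hmn h
    refine hab (c m) (h.symm.mono ?_ (hd m))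
    refine (hd n).trans ((hb _).trans ((hc (Nat.succ_le_of_lt hmn)).trans ?_))
    simp only [c, Function.iterate_succ_apply']
    exact le_rfl
  have hne : ∀ m n, m ≠ n → ¬ Compat (d m) (d n) := fun m n h =>
    h.lt_or_gt.elim (hlt m n) fun h h' => hlt n m h h'.symm
  refine ⟨Set.range d, Set.range_subset_iff.2 hdD, Set.infinite_range_of_injective ?_, ?_⟩
  · intro m n h
    by_contra hmn
    exact hne m n hmn (h ▸ Compat.of_le le_rfl)
  · rintro _ ⟨m, rfl⟩ _ ⟨n, rfl⟩ h
    exact hne m n fun hmn => h (by rw [hmn])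

/-- In a countable atomless forcing notion, below every condition `q` there is an infinite maximal
antichain whose elements decide whether `r` belongs to the generic filter. -/
theorem Atomless.exists_splitting [Countable Q] (hQ : Atomless Q) (q r : Q) :
    ∃ g : ℕ → Q, (∀ k, g k ≤ q) ∧ (∀ j k, j ≠ k → ¬ Compat (g j) (g k)) ∧
      (∀ s ≤ q, ∃ k, Compat s (g k)) ∧ ∀ k, Compat (g k) r → g k ≤ r := by
  let D : Set Q := {d | d ≤ q ∧ (Compat d r → d ≤ r)}
  have hD : ∀ s ≤ q, ∃ d ∈ D, d ≤ s := by
    intro s hs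
    by_cases h : Compat s r
    · obtain ⟨d, h₁, h₂⟩ := h
      exact ⟨d, ⟨h₁.trans hs, fun _ => h₂⟩, h₁⟩
    · exact ⟨s, ⟨hs, fun h' => absurd h' h⟩, le_rfl⟩
  obtain ⟨A₀, hA₀, hinf, hanti⟩ := hQ.exists_infinite_antichain q hD
  obtain ⟨A, hA, hAD, hAanti, hmax⟩ := exists_maximal_antichain hA₀ hanti
  have : Infinite A := (hinf.mono hA).to_subtype
  obtain ⟨g⟩ := nonempty_equiv_of_countable (α := ℕ) (β := A)
  refine ⟨fun k => g k, fun k => (hAD (g k).2).1, fun j k hjk => ?_, fun s hs => ?_,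
    fun k => (hAD (g k).2).2⟩
  · exact hAanti (g j).2 (g k).2 fun h => hjk (g.injective (Subtype.ext h))
  · obtain ⟨d, hd, hds⟩ := hD s hs
    obtain ⟨a, ha, hc⟩ := hmax d hd
    refine ⟨g.symm ⟨a, ha⟩, ?_⟩
    simpa using hc.mono hds le_rfl

/-- A countable atomless forcing notion has a dense subset isomorphic to the tree of finite
sequences of natural numbers. -/
theorem Atomless.exists_isDenseTree [Countable Q] [OrderTop Q] (hQ : Atomless Q) :
    ∃ e : List ℕ → Q, IsDenseTree e := by
  obtain ⟨f, hf⟩ := exists_surjective_nat Q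
  choose g hle hinc hpre hdec using hQ.exists_splitting
  -- The children of a node of length `n` decide the `n`th condition `f n`. Every level is predense,
  -- so some node of length `n + 1` is compatible with `f n`, hence below it.
  let e : List ℕ → Q := fun s => List.rec ⊤ (fun k s q => g q (f s.length) k) s
  have he : ∀ k s, e (k :: s) = g (e s) (f s.length) k := fun _ _ => rfl
  have hlev : ∀ (r : Q) (n : ℕ), ∃ s : List ℕ, s.length = n ∧ Compat r (e s) := by
    intro r n
    induction n with
    | zero => exact ⟨[], rfl, Compat.of_le le_top⟩
    | succ n ih =>
      obtain ⟨s, hs, t, htr, hts⟩ := ih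
      obtain ⟨k, hk⟩ := hpre (e s) (f s.length) t hts
      exact ⟨k :: s, by simp [hs], hk.mono htr le_rfl⟩
  refine ⟨e, fun k s => hle _ _ _, fun j k s hjk => hinc _ _ j k hjk, fun q => ?_⟩
  obtain ⟨n, rfl⟩ := hf q
  obtain ⟨s, hs, hc⟩ := hlev (f n) (n + 1)
  cases s with
  | nil => simp at hs
  | cons k s =>
    obtain rfl : s.length = n := by simpa using hs
    exact ⟨k :: s, hdec _ _ k hc.symm⟩

end DenseTree

/-! ### Generic filters obtained from a projection to a countable forcing notion -/

section Projection

variable {P : Type u} [Preorder P] {Q : Type v} [Preorder Q] {C : Type w} [Preorder C]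

/-- A projection of forcing notions. -/
structure IsProjection (π : P → Q) : Prop where
  mono : Monotone π
  lift : ∀ p, ∀ q ≤ π p, ∃ p' ≤ p, π p' ≤ q

/-- The name of the filter on `C` that corresponds to the generic filter on `Q` induced by the
projection `π`, where `Q` and `C` have isomorphic dense subsets `eQ` and `eC`. -/
def transferName (π : P → Q) (eQ : List ℕ → Q) (eC : List ℕ → C) : SubsetName C P :=
  fun c => {p | ∃ s, π p ≤ eQ s ∧ eC s ≤ c}

variable {π : P → Q} {eQ : List ℕ → Q} {eC : List ℕ → C}

theorem IsProjection.exists_denseTree_le (hπ : IsProjection π) (hQ : IsDenseTree eQ) (p : P) :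
    ∃ s, eQ s ≤ π p ∧ ∃ p' ≤ p, π p' ≤ eQ s := by
  obtain ⟨s, hs⟩ := hQ.dense (π p)
  exact ⟨s, hs, hπ.lift p _ hs⟩

theorem mem_transferName_mono (hπ : IsProjection π) {p q : P} {c : C} (hq : q ≤ p)
    (h : p ∈ transferName π eQ eC c) : q ∈ transferName π eQ eC c :=
  let ⟨s, h₁, h₂⟩ := h; ⟨s, (hπ.mono hq).trans h₁, h₂⟩

theorem has_of_mem {C : Type w} (h : SubsetName C P) {p : P} {c : C} (hp : p ∈ h c) : p ⊩ h.has c :=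
  fun q hq => ⟨q, le_rfl, p, hp, hq⟩

/-- The decoding direction: a condition that puts the Cohen node `eC s` into the filter must project
below the matching node `eQ s`. -/
theorem le_of_mem_transferName {P : Type u} {π : P → Q} (hQ : IsDenseTree eQ)
    (hC : IsDenseTree eC) {p : P} {s : List ℕ} (h : p ∈ transferName π eQ eC (eC s)) : π p ≤ eQ s :=
  let ⟨_, h₁, h₂⟩ := h; h₁.trans (hQ.le_of_suffix (hC.suffix_of_le h₂))

/-- Directedness holds because compatible nodes of a dense tree are comparable. To meet a dense set
`D`, pass from `q` to a node `eQ s` below its projection, extend `eC s` into `D` and on to a node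
`eC t`, and lift `eQ t` back to an extension of `q`. -/
theorem transferName_isGeneric (hπ : IsProjection π) (hQ : IsDenseTree eQ) (hC : IsDenseTree eC)
    (p : P) : p ⊩ (transferName π eQ eC).isGeneric := by
  refine ⟨?_, ?_, ?_⟩
  · rintro c ⟨d, hd⟩ q _ hc r hr
    obtain ⟨r', hr', s, ⟨t, h₁, h₂⟩, hs⟩ := hc r hr
    exact ⟨r', hr', s, ⟨t, h₁, h₂.trans hd⟩, hs⟩
  · rintro c d q _ ⟨hc, hd⟩ r hr
    obtain ⟨r₁, hr₁, a, ha, hra⟩ := hc r hr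
    obtain ⟨r₂, hr₂, b, hb, hrb⟩ := hd r₁ (hr₁.trans hr)
    obtain ⟨s, hs, hsc⟩ := mem_transferName_mono hπ (hr₂.trans hra) ha
    obtain ⟨t, ht, htd⟩ := mem_transferName_mono hπ hrb hb
    rcases hQ.suffix_or_suffix ⟨_, hs, ht⟩ with hst | hst
    · exact ⟨r₂, hr₂.trans hr₁, ⟨eC t, (hC.le_of_suffix hst).trans hsc, htd⟩,
        has_of_mem _ ⟨t, ht, le_rfl⟩⟩
    · exact ⟨r₂, hr₂.trans hr₁, ⟨eC s, hsc, (hC.le_of_suffix hst).trans htd⟩,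
        has_of_mem _ ⟨s, hs, le_rfl⟩⟩
  · rintro ⟨D, hD⟩ q _
    obtain ⟨s, hs, -⟩ := hπ.exists_denseTree_le hQ q
    obtain ⟨d, hdD, hd⟩ := hD (eC s)
    obtain ⟨t, ht⟩ := hC.dense d
    obtain ⟨r, hr, hrt⟩ := hπ.lift q (eQ t)
      ((hQ.le_of_suffix (hC.suffix_of_le (ht.trans hd))).trans hs)
    exact ⟨r, hr, ⟨d, hdD⟩, has_of_mem _ ⟨t, hrt, ht⟩⟩

end Projection

/-! ### Finite partial functions -/

namespace FinPFun

variable {X : Type v} {Y : Type w}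

theorem finite_graph (p : FinPFun X Y) : {a : X × Y | p.toFun a.1 = some a.2}.Finite := by
  refine Set.Finite.of_injOn (f := Prod.fst) (t := {x | p.toFun x ≠ none}) ?_ ?_ p.finite_dom
  · intro a ha
    simp only [Set.mem_ofPred_eq] at ha ⊢
    simp [ha]
  · intro a ha b hb hab
    simp only [Set.mem_ofPred_eq] at ha hb
    rw [hab, hb] at ha
    exact Prod.ext hab (Option.some_injective _ ha.symm)

/-- The graph of a finite partial function. -/
noncomputable def graph (p : FinPFun X Y) : Finset (X × Y) := p.finite_graph.toFinset

@[simp]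
theorem mem_graph {p : FinPFun X Y} {a : X × Y} : a ∈ p.graph ↔ p.toFun a.1 = some a.2 := by
  simp [graph]

theorem graph_injective : Function.Injective (graph : FinPFun X Y → Finset (X × Y)) := by
  intro p q h
  have hiff : ∀ x y, p.toFun x = some y ↔ q.toFun x = some y := fun x y => by
    simpa using (Finset.ext_iff.1 h) (x, y)
  exact le_antisymm (fun x y => (hiff x y).2) (fun x y => (hiff x y).1)

instance [Countable X] [Countable Y] : Countable (FinPFun X Y) :=
  graph_injective.countable

open Classical in
/-- Adding the pair `(x, y)` to a finite partial function. -/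
noncomputable def insert (p : FinPFun X Y) (x : X) (y : Y) : FinPFun X Y where
  toFun := Function.update p.toFun x (some y)
  finite_dom := by
    refine (p.finite_dom.insert x).subset fun z hz => ?_
    by_cases h : z = x
    · exact Or.inl h
    · right
      simpa [Function.update_of_ne h] using hz

theorem insert_self (p : FinPFun X Y) (x : X) (y : Y) : (p.insert x y).toFun x = some y := by
  simp [insert]

theorem insert_of_ne (p : FinPFun X Y) {x z : X} (y : Y) (h : z ≠ x) :
    (p.insert x y).toFun z = p.toFun z := by
  simp [insert, h]

theorem insert_le {p : FinPFun X Y} {x : X} (y : Y) (h : p.toFun x = none) : p.insert x y ≤ p := by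
  intro z m hz
  rw [insert_of_ne _ _ (fun hzx => by rw [hzx, h] at hz; cases hz)]
  exact hz

/-- The union of two finite partial functions, the first one taking precedence. -/
def union (p q : FinPFun X Y) : FinPFun X Y where
  toFun x := (p.toFun x).or (q.toFun x)
  finite_dom := by
    refine (p.finite_dom.union q.finite_dom).subset fun x hx => ?_
    by_contra hcon
    simp only [Set.mem_union, Set.mem_ofPred_eq, not_or, not_not] at hcon
    simp [hcon.1, hcon.2] at hx

theorem union_eq_some {p q : FinPFun X Y} {x : X} {y : Y} (h : (p.union q).toFun x = some y) :
    p.toFun x = some y ∨ q.toFun x = some y := by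
  simp only [union, Option.or_eq_some_iff] at h
  tauto

theorem union_le_left (p q : FinPFun X Y) : p.union q ≤ p := by
  intro x y h
  simp [union, h]

theorem union_le_right {p q : FinPFun X Y}
    (h : ∀ x y z, p.toFun x = some y → q.toFun x = some z → y = z) : p.union q ≤ q := by
  intro x z hz
  cases hp : p.toFun x with
  | none => simp [union, hp, hz]
  | some y => simp [union, hp, h x y z hp hz]

end FinPFun

theorem cohen_atomless : Atomless Cohen := by
  intro p
  obtain ⟨n, hn⟩ := p.finite_dom.exists_notMem
  simp only [Set.mem_ofPred_eq, not_not] at hn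
  refine ⟨p.insert n true, FinPFun.insert_le _ hn, p.insert n false, FinPFun.insert_le _ hn, ?_⟩
  rintro ⟨r, h₁, h₂⟩
  have e₁ := h₁ n true (FinPFun.insert_self _ _ _)
  rw [h₂ n false (FinPFun.insert_self _ _ _)] at e₁
  cases e₁

/-! ### Amalgamating and extending specializing conditions -/

namespace Specializing

variable {T : Type u} [PartialOrder T]

theorem compat_of_forall {p q : Specializing T}
    (hagree : ∀ t m n, p.1.toFun t = some m → q.1.toFun t = some n → m = n)
    (hcol : ∀ s t m, p.1.toFun s = some m → q.1.toFun t = some m → ¬ s < t ∧ ¬ t < s) :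
    Compat p q := by
  refine ⟨⟨p.1.union q.1, ?_⟩, FinPFun.union_le_left _ _, FinPFun.union_le_right hagree⟩
  rintro s t hst m n hm hn rfl
  rcases FinPFun.union_eq_some hm with hs | hs <;> rcases FinPFun.union_eq_some hn with ht | ht
  · exact p.2 s t hst m m hs ht rfl
  · exact (hcol s t m hs ht).1 hst
  · exact (hcol t s m ht hs).2 hst
  · exact q.2 s t hst m m hs ht rfl

theorem exists_insert (p : Specializing T) {t : T} {n : ℕ} (ht : p.1.toFun t = none)
    (hcol : ∀ s, p.1.toFun s = some n → ¬ s < t ∧ ¬ t < s) :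
    ∃ q ≤ p, q.1.toFun t = some n ∧ ∀ s m, q.1.toFun s = some m →
      p.1.toFun s = some m ∨ (s = t ∧ m = n) := by
  have key : ∀ s m, (p.1.insert t n).toFun s = some m →
      p.1.toFun s = some m ∨ (s = t ∧ m = n) := by
    intro s m hs
    by_cases h : s = t
    · subst h
      rw [FinPFun.insert_self] at hs
      exact Or.inr ⟨rfl, (Option.some_injective _ hs).symm⟩
    · rw [FinPFun.insert_of_ne _ _ h] at hs
      exact Or.inl hs
  refine ⟨⟨p.1.insert t n, ?_⟩, FinPFun.insert_le n ht, FinPFun.insert_self _ _ _, key⟩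
  rintro a b hab m m' ha hb rfl
  rcases key a m ha with hpa | ⟨rfl, rfl⟩ <;> rcases key b _ hb with hpb | ⟨rfl, h⟩
  · exact p.2 a b hab m m hpa hpb rfl
  · subst h
    exact (hcol a hpa).1 hab
  · exact (hcol b hpb).2 hab
  · exact lt_irrefl _ hab

theorem finite_colors (p : Specializing T) : {n | ∃ t, p.1.toFun t = some n}.Finite := by
  refine (p.1.finite_graph.image Prod.snd).subset ?_
  rintro n ⟨t, ht⟩
  exact ⟨(t, n), ht, rfl⟩

end Specializing

/-! ### The countable chain condition -/

section CCC

open Filter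

variable {T : Type u} [PartialOrder T]

/-- An uncountable family of finite sets of bounded size has an uncountable subfamily all of whose
members contain a finite set `r`, every point outside of `r` lying in only countably many members
of the subfamily. -/
theorem exists_root {I : Type v} {X : Type w} (f : I → Finset X) (n : ℕ) {A : Set I}
    (hA : ¬ A.Countable) (hf : ∀ i ∈ A, (f i).card ≤ n) :
    ∃ r : Finset X, ¬ {i ∈ A | r ⊆ f i}.Countable ∧
      ∀ x ∉ r, {i ∈ A | r ⊆ f i ∧ x ∈ f i}.Countable := by
  classical
  -- Take `r` of the largest possible size, at most `n`, among the sets contained in uncountably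
  -- many members; adding a point that violates the second claim would give a larger one.
  let K : ℕ → Prop := fun k => ∃ r : Finset X, r.card = k ∧ ¬ {i ∈ A | r ⊆ f i}.Countable
  have h0 : K 0 := ⟨∅, rfl, by simpa using hA⟩
  obtain ⟨r, hr, hunc⟩ := Nat.findGreatest_spec (P := K) (Nat.zero_le n) h0
  refine ⟨r, hunc, fun x hx => ?_⟩
  by_contra hcon
  have hsub : {i ∈ A | r ⊆ f i ∧ x ∈ f i} = {i ∈ A | insert x r ⊆ f i} := by
    ext i
    simp only [Set.mem_ofPred_eq, Finset.insert_subset_iff]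
    tauto
  rw [hsub] at hcon
  have hne : {i ∈ A | insert x r ⊆ f i}.Nonempty := by
    rw [Set.nonempty_iff_ne_empty]
    intro h
    exact hcon (h ▸ Set.countable_empty)
  obtain ⟨i, hi, hsubi⟩ := hne
  refine Nat.findGreatest_is_greatest (P := K) (n := n) (k := (insert x r).card) ?_
    ((Finset.card_le_card hsubi).trans (hf i hi)) ⟨_, rfl, hcon⟩
  rw [← hr, Finset.card_insert_of_notMem hx]
  exact Nat.lt_succ_self _

/-- If `T` is a partial order in which all chains are countable and the initial segments are
chains, the forcing specializing `T` satisfies the countable chain condition. -/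
theorem Specializing.ccc (hchain : ∀ b : Set T, IsChain (· ≤ ·) b → b.Countable)
    (hIic : ∀ t : T, IsChain (· ≤ ·) (Set.Iic t)) : CCC (Specializing T) := by
  classical
  intro A₀ hA₀
  by_contra hunc₀
  obtain ⟨n, hunc₁⟩ : ∃ n, ¬ {p ∈ A₀ | p.1.graph.card = n}.Countable := by
    by_contra! hcon
    refine hunc₀ ((Set.countable_iUnion hcon).mono fun p hp => ?_)
    exact Set.mem_iUnion.2 ⟨_, hp, rfl⟩
  obtain ⟨r, hunc, hr⟩ := exists_root (fun p : Specializing T => p.1.graph) n hunc₁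
    (fun p hp => hp.2.le)
  set B : Set (Specializing T) :=
    {p | p ∈ {p ∈ A₀ | p.1.graph.card = n} ∧ r ⊆ p.1.graph}
  let R : Set T := {t | ∃ m, (t, m) ∈ r}
  have hrB : ∀ (p : B) t m, (t, m) ∈ r → p.1.1.toFun t = some m := fun p t m h =>
    FinPFun.mem_graph.1 (p.2.2 h)
  have hR : ∀ t ∉ R, {p : B | ∃ m, p.1.1.toFun t = some m}.Countable := by
    intro t ht
    have : {p : B | ∃ m, p.1.1.toFun t = some m} =
        ⋃ m : ℕ, {p : B | p.1.1.toFun t = some m} := by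
      ext p; simp
    rw [this]
    refine Set.countable_iUnion fun m => ?_
    refine Set.countable_of_injective_of_countable_image (f := Subtype.val)
      Subtype.val_injective.injOn ((hr (t, m) fun h => ht ⟨m, h⟩).mono ?_)
    rintro _ ⟨p, hp, rfl⟩
    exact ⟨p.2.1, p.2.2, FinPFun.mem_graph.2 hp⟩
  have hne : (cocountable (α := B)).NeBot := by
    rw [neBot_iff, Ne, ← empty_mem_iff_bot, mem_cocountable, Set.compl_empty,
      Set.countable_univ_iff]
    exact fun h => hunc (Set.countable_coe_iff.1 h)
  -- Extending the cocountable filter to an ultrafilter lets finitely many cases, valid for almost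
  -- all `b`, be reduced to a single one, while countable sets stay negligible.
  let U : Ultrafilter B := Ultrafilter.of cocountable
  have hU : ∀ S : Set B, S.Countable → ∀ᶠ b in U, b ∉ S := fun S hS =>
    Ultrafilter.of_le _ (mem_cocountable.2 (by
      have : ({b | b ∉ S}ᶜ : Set B) = S := by ext; simp
      rwa [this]))
  have henum : ∀ b : B, ∃ e : Fin n → T, ∀ t m, b.1.1.toFun t = some m →
      ∃ j, e j = t := by
    intro b
    refine ⟨fun j => ((Finset.equivFinOfCardEq b.2.1.2).symm j).1.1, fun t m ht => ?_⟩
    refine ⟨Finset.equivFinOfCardEq b.2.1.2 ⟨(t, m), FinPFun.mem_graph.2 ht⟩, ?_⟩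
    simp only [Equiv.symm_apply_apply]
  choose e he using henum
  -- For almost all `b`, the domains of `a` and `b` meet only inside `R`, so their incompatibility
  -- is caused by comparable nodes outside `R`. There are finitely many choices of a node of `a` and
  -- an index in `b`, so one choice serves almost all `b`.
  have hpair : ∀ a : B, ∃ s ∈ {t | a.1.1.toFun t ≠ none}, ∃ j, ∀ᶠ b in U,
      s ∉ R ∧ e b j ∉ R ∧ (∃ m, b.1.1.toFun (e b j) = some m) ∧ (s < e b j ∨ e b j < s) := by
    intro a
    have hev : ∀ᶠ b in U, ∃ s ∈ {t | a.1.1.toFun t ≠ none}, ∃ j,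
        s ∉ R ∧ e b j ∉ R ∧ (∃ m, b.1.1.toFun (e b j) = some m) ∧ (s < e b j ∨ e b j < s) := by
      have h₁ : ∀ᶠ b in U, b ∉ ({a} : Set B) := hU _ (Set.countable_singleton a)
      have h₂ : ∀ᶠ b in U, b ∉ ⋃ t ∈ {t | a.1.1.toFun t ≠ none} \ R,
          {p : B | ∃ m, p.1.1.toFun t = some m} :=
        hU _ ((a.1.1.finite_dom.subset Set.sdiff_subset).countable.biUnion fun t ht => hR t ht.2)
      filter_upwards [h₁, h₂] with b hb₁ hb₂
      by_contra hcon
      refine hA₀ a.2.1.1 b.2.1.1 (fun h => hb₁ (Subtype.ext h.symm)) ?_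
      have hdis : ∀ t m k, a.1.1.toFun t = some m → b.1.1.toFun t = some k → t ∈ R := by
        intro t m k hm hk
        by_contra ht
        exact hb₂ (Set.mem_biUnion (x := t) ⟨by simp [hm], ht⟩ ⟨k, hk⟩)
      refine compat_of_forall ?_ ?_
      · intro t m k hm hk
        obtain ⟨l, hl⟩ := hdis t m k hm hk
        have e₁ := hrB a t l hl
        have e₂ := hrB b t l hl
        rw [hm] at e₁
        rw [hk] at e₂
        exact Option.some_injective _ (e₁.trans e₂.symm)
      · intro s t m hs ht
        by_contra hst
        have hst' : s < t ∨ t < s := by tauto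
        -- On `R` the two conditions agree, so a clash involving a node of `R` would already occur
        -- within one condition.
        by_cases hsR : s ∈ R
        · obtain ⟨l, hl⟩ := hsR
          have e₁ := hrB a s l hl
          rw [hs] at e₁
          have e₂ := hrB b s l hl
          rw [← e₁] at e₂
          rcases hst' with h | h
          · exact b.1.2 s t h m m e₂ ht rfl
          · exact b.1.2 t s h m m ht e₂ rfl
        by_cases htR : t ∈ R
        · obtain ⟨l, hl⟩ := htR
          have e₁ := hrB b t l hl
          rw [ht] at e₁
          have e₂ := hrB a t l hl
          rw [← e₁] at e₂
          rcases hst' with h | h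
          · exact a.1.2 s t h m m hs e₂ rfl
          · exact a.1.2 t s h m m e₂ hs rfl
        obtain ⟨j, rfl⟩ := he b t m ht
        exact hcon ⟨s, by simp [hs], j, hsR, htR, ⟨m, ht⟩, hst'⟩
    obtain ⟨s, hs, h⟩ := (Ultrafilter.eventually_exists_mem_iff a.1.1.finite_dom).1 hev
    exact ⟨s, hs, Ultrafilter.eventually_exists_iff.1 h⟩
  choose s hs j hj using hpair
  have hsR : ∀ a, s a ∉ R := fun a => (hj a).exists.choose_spec.1
  obtain ⟨k, hk⟩ : ∃ k, ¬ {a | j a = k}.Countable := by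
    by_contra! hcon
    refine hunc (Set.countable_coe_iff.1 (Set.countable_univ_iff.1 ?_))
    exact (Set.countable_iUnion hcon).mono fun a _ => Set.mem_iUnion.2 ⟨j a, rfl⟩
  -- The other case, `e b k < s a`, is negligible: `s a` has countably many predecessors, and each
  -- one outside `R` is in the domain of countably many `b`.
  have habove : ∀ a, j a = k → ∀ᶠ b in U, s a < e b k := by
    rintro a rfl
    have h : ∀ᶠ b in U, b ∉ ⋃ t ∈ Set.Iic (s a) \ R, {p : B | ∃ m, p.1.1.toFun t = some m} :=
      hU _ (((hchain _ (hIic (s a))).mono Set.sdiff_subset).biUnion fun t ht => hR t ht.2)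
    filter_upwards [hj a, h] with b hb hb'
    rcases hb.2.2.2 with h | h
    · exact h
    · have hmem : e b (j a) ∈ Set.Iic (s a) \ R := ⟨h.le, hb.2.1⟩
      exact absurd (Set.mem_biUnion hmem hb.2.2.1) hb'
  -- For any two such `a` and `a'`, almost every `b` has `e b k` above both `s a` and `s a'`, which
  -- are thus comparable.
  have hS : IsChain (· ≤ ·) (s '' {a | j a = k}) := by
    rintro _ ⟨a, ha, rfl⟩ _ ⟨a', ha', rfl⟩ hne
    obtain ⟨b, hb, hb'⟩ := ((habove a ha).and (habove a' ha')).exists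
    exact hIic (e b k) hb.le hb'.le hne
  -- The chain is countable, and each of its nodes, lying outside `R`, belongs to the domain of
  -- countably many conditions; this contradicts the choice of `k`.
  refine hk (((hchain _ hS).biUnion (t := fun t _ => {p : B | ∃ m, p.1.1.toFun t = some m})
    ?_).mono ?_)
  · rintro _ ⟨a, _, rfl⟩
    exact hR _ (hsR a)
  · intro a ha
    exact Set.mem_biUnion (Set.mem_image_of_mem s ha) (Option.ne_none_iff_exists'.1 (hs a))

end CCC

end Forcing

/-! ### Heights of nodes -/

namespace SetTree

variable {T : Type u} [PartialOrder T] [IsTree T]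

/-- The height of a node: the order type of its set of strict predecessors. -/
noncomputable def nodeHeight (t : T) : Ordinal.{u} := Ordinal.type (fun a b : Set.Iio t => a < b)

theorem mem_level {t : T} {α : Ordinal.{u}} : t ∈ level T α ↔ nodeHeight t = α := Iff.rfl

theorem isChain_Iic (t : T) : IsChain (· ≤ ·) (Set.Iic t) := by
  intro a ha b hb hne
  rcases (Set.mem_Iic.1 ha).eq_or_lt with rfl | ha
  · exact Or.inr hb
  rcases (Set.mem_Iic.1 hb).eq_or_lt with rfl | hb
  · exact Or.inl ha.le
  rcases trichotomous_of (fun a b : Set.Iio t => a < b) ⟨a, ha⟩ ⟨b, hb⟩ with h | h | h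
  · exact Or.inl (le_of_lt h)
  · exact absurd (congrArg Subtype.val h) hne
  · exact Or.inr (le_of_lt h)

theorem lt_trichotomy_of_le {a b t : T} (ha : a ≤ t) (hb : b ≤ t) : a < b ∨ a = b ∨ b < a := by
  rcases eq_or_ne a b with h | h
  · exact Or.inr (Or.inl h)
  · rcases isChain_Iic t ha hb h with h' | h'
    · exact Or.inl (h'.lt_of_ne h)
    · exact Or.inr (Or.inr (h'.lt_of_ne h.symm))

theorem nodeHeight_eq_typein {s t : T} (h : s < t) :
    nodeHeight s = Ordinal.typein (fun a b : Set.Iio t => a < b) ⟨s, h⟩ := by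
  rw [← Ordinal.type_subrel]
  refine RelIso.ordinalType_congr ⟨⟨fun a => ⟨⟨a.1, lt_trans a.2 h⟩, a.2⟩,
    fun a => ⟨a.1.1, a.2⟩, fun _ => rfl, fun _ => rfl⟩, ?_⟩
  intro a b
  exact Iff.rfl

theorem nodeHeight_lt_nodeHeight {s t : T} (h : s < t) : nodeHeight s < nodeHeight t := by
  rw [nodeHeight_eq_typein h]
  exact Ordinal.typein_lt_type _ _

theorem exists_le_nodeHeight_eq {t : T} {α : Ordinal.{u}} (h : α ≤ nodeHeight t) :
    ∃ s ≤ t, nodeHeight s = α := by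
  rcases h.eq_or_lt with rfl | h
  · exact ⟨t, le_rfl, rfl⟩
  · obtain ⟨⟨s, hs⟩, rfl⟩ := Ordinal.typein_surj _ h
    exact ⟨s, le_of_lt hs, nodeHeight_eq_typein hs⟩

theorem eq_of_nodeHeight_eq {a b t : T} (ha : a ≤ t) (hb : b ≤ t)
    (h : nodeHeight a = nodeHeight b) : a = b := by
  rcases lt_trichotomy_of_le ha hb with h' | h' | h'
  · exact absurd h (nodeHeight_lt_nodeHeight h').ne
  · exact h'
  · exact absurd h (nodeHeight_lt_nodeHeight h').ne'

theorem exists_trunc (δ : Ordinal.{u}) (t : T) : ∃ s ≤ t, nodeHeight s = min (nodeHeight t) δ :=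
  exists_le_nodeHeight_eq (min_le_left _ _)

/-- The predecessor of `t` of height `δ`, or `t` itself if its height is at most `δ`. -/
noncomputable def trunc (δ : Ordinal.{u}) (t : T) : T := (exists_trunc δ t).choose

variable {δ : Ordinal.{u}}

theorem trunc_le (t : T) : trunc δ t ≤ t := (exists_trunc δ t).choose_spec.1

theorem nodeHeight_trunc (t : T) : nodeHeight (trunc δ t) = min (nodeHeight t) δ :=
  (exists_trunc δ t).choose_spec.2

theorem trunc_eq_self {t : T} (h : nodeHeight t ≤ δ) : trunc δ t = t :=
  eq_of_nodeHeight_eq (trunc_le t) le_rfl (by rw [nodeHeight_trunc, min_eq_left h])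

theorem trunc_eq_of_le {s t : T} (hst : s ≤ t) (hs : nodeHeight s = δ) : trunc δ t = s := by
  refine eq_of_nodeHeight_eq (trunc_le t) hst ?_
  rw [nodeHeight_trunc, hs, min_eq_right]
  rcases hst.eq_or_lt with rfl | h
  · exact hs.ge
  · exact hs ▸ (nodeHeight_lt_nodeHeight h).le

theorem eq_of_nodeHeight_trunc_lt {t : T} (h : nodeHeight (trunc δ t) < δ) : trunc δ t = t := by
  rw [nodeHeight_trunc, min_lt_iff] at h
  exact trunc_eq_self (h.resolve_right (lt_irrefl _)).le

/-! ### Aronszajn trees -/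

namespace IsGenAronszajn

theorem countable_chain (hT : IsGenAronszajn T) (b : Set T) (hb : IsChain (· ≤ ·) b) :
    b.Countable := by
  obtain ⟨M, hM, hbM⟩ := hb.exists_maxChain
  exact (hT.branch_countable M hM).mono hbM

theorem nodeHeight_lt (hT : IsGenAronszajn T) (t : T) : nodeHeight t < Ordinal.omega 1 := by
  have hc : (Set.Iio t).Countable := (hT.countable_chain _ (isChain_Iic t)).mono
    Set.Iio_subset_Iic_self
  rw [← Cardinal.ord_aleph, Cardinal.lt_ord, nodeHeight, Ordinal.card_type]
  exact (Cardinal.mk_le_aleph0_iff.2 (Set.countable_coe_iff.2 hc)).trans_lt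
    Cardinal.aleph0_lt_aleph_one

theorem exists_nodeHeight_eq (hT : IsGenAronszajn T) {α : Ordinal.{u}} (h : α < Ordinal.omega 1) :
    ∃ t : T, nodeHeight t = α := by
  by_contra hcon
  have hα : level T α = ∅ := Set.eq_empty_iff_forall_notMem.2 fun t ht => hcon ⟨t, ht⟩
  exact absurd (hT.height.2 hα) (not_le.2 h)

theorem exists_ge_nodeHeight_eq (hT : IsGenAronszajn T) (t : T) {α : Ordinal.{u}}
    (hα : nodeHeight t ≤ α) (h : α < Ordinal.omega 1) : ∃ s, t ≤ s ∧ nodeHeight s = α := by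
  obtain ⟨s, hs, hst⟩ := hT.normal.comparable t α h
  rw [mem_level] at hs
  refine ⟨s, ?_, hs⟩
  rcases hst with hst | hst
  · rcases hst.eq_or_lt with rfl | hlt
    · exact le_rfl
    · exact absurd (nodeHeight_lt_nodeHeight hlt) (not_lt.2 (hs ▸ hα))
  · exact hst

/-- By normality `t` has extensions at the infinitely many heights `nodeHeight t + n`. They provide
uncoloured nodes above a node of height `δ`. -/
theorem infinite_Ici (hT : IsGenAronszajn T) (t : T) : (Set.Ici t).Infinite := by
  have hlt : ∀ n : ℕ, nodeHeight t + n < Ordinal.omega 1 := fun n =>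
    (Ordinal.isPrincipal_add_omega 1) (hT.nodeHeight_lt t)
      ((Ordinal.natCast_lt_omega0 n).trans Ordinal.omega0_lt_omega_one)
  choose s hs hs' using fun n : ℕ =>
    hT.exists_ge_nodeHeight_eq t (α := nodeHeight t + n) le_self_add (hlt n)
  refine (Set.infinite_range_of_injective (f := s) ?_).mono (Set.range_subset_iff.2 hs)
  intro m n h
  have := (hs' m).symm.trans ((congrArg nodeHeight h).trans (hs' n))
  simpa using this

theorem infinite_nodeHeight_lt (hT : IsGenAronszajn T) (hδ : Ordinal.omega0 ≤ δ) :
    {t : T | nodeHeight t < δ}.Infinite := by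
  choose s hs using fun n : ℕ => hT.exists_nodeHeight_eq (α := n)
    ((Ordinal.natCast_lt_omega0 n).trans Ordinal.omega0_lt_omega_one)
  refine (Set.infinite_range_of_injective (f := s) ?_).mono (Set.range_subset_iff.2 fun n => ?_)
  · intro m n h
    have := (hs m).symm.trans ((congrArg nodeHeight h).trans (hs n))
    simpa using this
  · simp only [Set.mem_ofPred_eq, hs]
    exact (Ordinal.natCast_lt_omega0 n).trans_le hδ

end IsGenAronszajn

theorem HasCountableLevels.countable_nodeHeight_le (hlev : HasCountableLevels T)
    (hδ : δ < Ordinal.omega 1) : {t : T | nodeHeight t ≤ δ}.Countable := by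
  have hsub : {t : T | nodeHeight t ≤ δ} ⊆ ⋃ α ∈ Set.Iic δ, level T α := fun t ht =>
    Set.mem_biUnion (show nodeHeight t ∈ Set.Iic δ from ht) rfl
  refine (Set.Countable.biUnion ?_ fun α _ => hlev α).mono hsub
  have hδ' : Order.succ δ < Ordinal.omega 1 := (Cardinal.isSuccLimit_omega 1).succ_lt hδ
  rw [← Order.Iio_succ, ← Set.countable_coe_iff, ← Cardinal.mk_le_aleph0_iff,
    Cardinal.mk_Iio_ordinal, Cardinal.lift_le_aleph0, ← Order.lt_succ_iff, Cardinal.succ_aleph0,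
    ← Cardinal.lt_ord, Cardinal.ord_aleph]
  exact hδ'

end SetTree

/-! ### The projection to the part of the tree below a countable level -/

namespace Forcing

open SetTree

variable {T : Type u} [PartialOrder T] [IsTree T]

/-- The information about nodes of height at most `δ` contained in the condition `p`: the colours
of the nodes of height less than `δ`, and for each node of height `δ` the colours of the nodes
above it. -/
def trace (δ : Ordinal.{u}) (p : Specializing T) : Set (T × ℕ) :=
  {a | ∃ t, p.1.toFun t = some a.2 ∧ trunc δ t = a.1}

/-- The forcing notion of all traces of conditions, ordered by reverse inclusion. -/
abbrev Trace (T : Type u) [PartialOrder T] [IsTree T] (δ : Ordinal.{u}) :=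
  {F : (Set (T × ℕ))ᵒᵈ // ∃ p : Specializing T, F = OrderDual.toDual (trace δ p)}

/-- The map sending a condition to its trace. -/
def toTrace (δ : Ordinal.{u}) (p : Specializing T) : Trace T δ :=
  ⟨OrderDual.toDual (trace δ p), p, rfl⟩

variable {δ : Ordinal.{u}}

theorem toTrace_le_iff {p q : Specializing T} :
    toTrace δ p ≤ toTrace δ q ↔ trace δ q ⊆ trace δ p := Iff.rfl

theorem exists_toTrace_eq (F : Trace T δ) : ∃ p, toTrace δ p = F :=
  let ⟨_, p, hp⟩ := F; ⟨p, Subtype.ext hp.symm⟩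

theorem trace_mono {p q : Specializing T} (h : p ≤ q) : trace δ q ⊆ trace δ p :=
  fun _ ⟨t, ht, ht'⟩ => ⟨t, h t _ ht, ht'⟩

theorem finite_trace (p : Specializing T) : (trace δ p).Finite := by
  refine (p.1.finite_graph.image fun a => (trunc δ a.1, a.2)).subset ?_
  rintro ⟨s, n⟩ ⟨t, ht, rfl⟩
  exact ⟨(t, n), ht, rfl⟩

theorem eq_some_of_mem_trace {p : Specializing T} {t : T} {n : ℕ} (ht : nodeHeight t < δ)
    (h : (t, n) ∈ trace δ p) : p.1.toFun t = some n := by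
  obtain ⟨s, hs, rfl⟩ := h
  rwa [eq_of_nodeHeight_trunc_lt ht]

theorem mem_trace_of_eq_some {p : Specializing T} {t : T} {n : ℕ} (ht : nodeHeight t ≤ δ)
    (h : p.1.toFun t = some n) : (t, n) ∈ trace δ p :=
  ⟨t, h, trunc_eq_self ht⟩

noncomputable instance : OrderTop (Trace T δ) where
  top := toTrace δ ⊤
  le_top F := by
    obtain ⟨p, rfl⟩ := exists_toTrace_eq F
    exact trace_mono le_top

/-- Below height `δ` truncation does nothing, so the trace retains the exact colouring there. This
is why the projected generic filter knows which such `d` are in the generic filter. -/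
theorem le_of_toTrace_le {p d : Specializing T} (hd : ∀ t, d.1.toFun t ≠ none → nodeHeight t < δ)
    (h : toTrace δ p ≤ toTrace δ d) : p ≤ d := by
  intro t n ht
  have hlt := hd t (by simp [ht])
  exact eq_some_of_mem_trace hlt (toTrace_le_iff.1 h (mem_trace_of_eq_some hlt.le ht))

theorem countable_Trace (hlev : HasCountableLevels T) (hδ : δ < Ordinal.omega 1) :
    Countable (Trace T δ) := by
  have hc := Set.countable_ofPred_finite_subset
    ((hlev.countable_nodeHeight_le hδ).prod (Set.countable_univ (α := ℕ)))
  refine Set.countable_coe_iff.2 (hc.mono ?_)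
  rintro F ⟨p, rfl⟩
  refine ⟨finite_trace p, ?_⟩
  rintro ⟨_, n⟩ ⟨t, _, rfl⟩
  exact ⟨(nodeHeight_trunc t).trans_le (min_le_right _ _), Set.mem_univ _⟩

/-- Some node below `δ` is still uncoloured, as there are infinitely many; either of two colours not
used by `p` may be put on it, and the trace shows which. -/
theorem atomless_Trace (hT : IsGenAronszajn T) (hδ : Ordinal.omega0 ≤ δ) :
    Atomless (Trace T δ) := by
  intro F
  obtain ⟨p, rfl⟩ := exists_toTrace_eq F
  obtain ⟨t, ht, htp⟩ := ((hT.infinite_nodeHeight_lt hδ).sdiff p.1.finite_dom).nonempty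
  simp only [Set.mem_ofPred_eq, not_not] at ht htp
  obtain ⟨m, hm⟩ := p.finite_colors.exists_notMem
  obtain ⟨n, hn⟩ := (p.finite_colors.insert m).exists_notMem
  rw [Set.mem_insert_iff, not_or] at hn
  obtain ⟨q, hq, hqt, -⟩ := p.exists_insert (n := m) htp fun s hs => absurd ⟨s, hs⟩ hm
  obtain ⟨r, hr, hrt, -⟩ := p.exists_insert (n := n) htp fun s hs => absurd ⟨s, hs⟩ hn.2
  refine ⟨toTrace δ q, trace_mono hq, toTrace δ r, trace_mono hr, ?_⟩
  rintro ⟨G, hGq, hGr⟩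
  obtain ⟨g, rfl⟩ := exists_toTrace_eq G
  have e₁ := eq_some_of_mem_trace ht (hGq (mem_trace_of_eq_some ht.le hqt))
  have e₂ := eq_some_of_mem_trace ht (hGr (mem_trace_of_eq_some ht.le hrt))
  rw [e₁] at e₂
  exact hn.1 (Option.some_injective _ e₂).symm

/-- Adding one element of the trace of `q` to the trace of an extension of `p`. -/
theorem exists_le_mem_trace (hT : IsGenAronszajn T) {p q : Specializing T}
    (hpq : trace δ p ⊆ trace δ q) {a : T × ℕ} (ha : a ∈ trace δ q) :
    ∃ p' ≤ p, trace δ p' ⊆ trace δ q ∧ a ∈ trace δ p' := by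
  by_cases hap : a ∈ trace δ p
  · exact ⟨p, le_rfl, hpq, hap⟩
  obtain ⟨b, n⟩ := a
  have hb : nodeHeight b ≤ δ := by
    obtain ⟨w, -, rfl⟩ := ha
    exact (nodeHeight_trunc w).trans_le (min_le_right _ _)
  -- The colour `n` goes on `b` itself if its height is below `δ`, and otherwise on an uncoloured
  -- node at or above `b`. In the first case `b` is uncoloured in `p`: its colour would have to be
  -- that of `q`, namely `n`, so `(b, n)` would already be in the trace of `p`.
  obtain ⟨t, htp, htb⟩ : ∃ t, p.1.toFun t = none ∧ trunc δ t = b := by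
    rcases hb.eq_or_lt with hb | hlt
    · obtain ⟨t, ht, htp⟩ := ((hT.infinite_Ici b).sdiff p.1.finite_dom).nonempty
      exact ⟨t, not_not.1 htp, trunc_eq_of_le ht hb⟩
    · refine ⟨b, ?_, trunc_eq_self hb⟩
      by_contra hne
      obtain ⟨m, hm⟩ := Option.ne_none_iff_exists'.1 hne
      have e₁ := eq_some_of_mem_trace hlt (hpq (mem_trace_of_eq_some hb hm))
      rw [eq_some_of_mem_trace hlt ha] at e₁
      rw [← Option.some_injective _ e₁] at hm
      exact hap (mem_trace_of_eq_some hb hm)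
  -- If `s` clashed with `t`, their truncations would be comparable. If these are equal, `(b, n)` is
  -- already in the trace of `p`. Otherwise the lower one has height below `δ`, so `q` colours it
  -- `n`, and also colours `n` some node at or above the upper one: a clash inside `q`.
  have hcol : ∀ s, p.1.toFun s = some n → ∀ z, s ≤ z → t ≤ z → False := by
    intro s hs z hsz htz
    have hsq : (trunc δ s, n) ∈ trace δ q := hpq ⟨s, hs, rfl⟩
    rcases lt_trichotomy_of_le ((trunc_le (δ := δ) s).trans hsz) ((trunc_le (δ := δ) t).trans htz)
      with h | h | h
    · have hlt : nodeHeight (trunc δ s) < δ := (nodeHeight_lt_nodeHeight h).trans_le (htb ▸ hb)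
      obtain ⟨w, hw, hwb⟩ := ha
      refine q.2 _ w (h.trans_le ?_) n n (eq_some_of_mem_trace hlt hsq) hw rfl
      rw [htb]
      exact hwb.symm.trans_le (trunc_le w)
    · exact hap ⟨s, hs, h.trans htb⟩
    · obtain ⟨v, hv, hvs⟩ := hsq
      simp only at hvs
      rw [htb, ← hvs] at h
      have hlt : nodeHeight b < δ := (nodeHeight_lt_nodeHeight h).trans_le
        ((nodeHeight_trunc v).trans_le (min_le_right _ _))
      exact q.2 b v (h.trans_le (trunc_le v)) n n (eq_some_of_mem_trace hlt ha) hv rfl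
  obtain ⟨p', hp', ht, hp'p⟩ := p.exists_insert (n := n) htp fun s hs =>
    ⟨fun h => hcol s hs t h.le le_rfl, fun h => hcol s hs s le_rfl h.le⟩
  refine ⟨p', hp', ?_, t, ht, htb⟩
  rintro ⟨c, m⟩ ⟨s, hs, hsc⟩
  rcases hp'p s m hs with h | ⟨rfl, h⟩
  · exact hpq ⟨s, h, hsc⟩
  · simp only at hs hsc h
    rw [← hsc, htb, h]
    exact ha

/-- The trace of `q` is finite, so its elements can be added to `p` one at a time, the trace staying
inside that of `q` so that `exists_le_mem_trace` applies again. -/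
theorem isProjection_toTrace (hT : IsGenAronszajn T) (δ : Ordinal.{u}) :
    IsProjection (toTrace δ : Specializing T → Trace T δ) where
  mono _ _ h := trace_mono h
  lift p F hF := by
    obtain ⟨q, rfl⟩ := exists_toTrace_eq F
    have key : ∃ p' ≤ p, trace δ p' ⊆ trace δ q ∧ trace δ q ⊆ trace δ p' := by
      refine Set.Finite.induction_on_subset
        (motive := fun S _ => ∃ p' ≤ p, trace δ p' ⊆ trace δ q ∧ S ⊆ trace δ p')
        (trace δ q) (finite_trace q) ⟨p, le_rfl, hF, Set.empty_subset _⟩ ?_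
      rintro a S ha - - ⟨p₁, hp₁, hsub, hS⟩
      obtain ⟨p₂, hp₂, hsub', ha'⟩ := exists_le_mem_trace hT hsub ha
      exact ⟨p₂, hp₂.trans hp₁, hsub', Set.insert_subset ha' (hS.trans (trace_mono hp₂))⟩
    obtain ⟨p', hp', -, h⟩ := key
    exact ⟨p', hp', h⟩

/-! ### Bounding the relevant conditions and building the Cohen name -/

open SetTree PName

variable {T : Type u} [PartialOrder T] [IsTree T]

/-- Countably many conditions have their domains below some level `δ < ω₁`. -/
theorem exists_nodeHeight_bound (hT : IsGenAronszajn T) {D : Set (Specializing T)}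
    (hD : D.Countable) : ∃ δ < Ordinal.omega.{u} 1, Ordinal.omega0 ≤ δ ∧
      ∀ d ∈ D, ∀ t, d.1.toFun t ≠ none → nodeHeight t < δ := by
  have hS : (⋃ d ∈ D, {t | d.1.toFun t ≠ none}).Countable :=
    hD.biUnion fun d _ => d.1.finite_dom.countable
  have : Countable ↥(⋃ d ∈ D, {t | d.1.toFun t ≠ none}) := hS.to_subtype
  have hlt := Ordinal.iSup_lt_omega_one
    (f := fun t : ↥(⋃ d ∈ D, {t | d.1.toFun t ≠ none}) => nodeHeight t.1)
    fun t => hT.nodeHeight_lt t.1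
  -- The maximum with `ω` secures infinitely many nodes below `δ`, as needed for atomlessness of the
  -- traces.
  refine ⟨max Ordinal.omega0 (Order.succ _), max_lt Ordinal.omega0_lt_omega_one
    ((Cardinal.isSuccLimit_omega 1).succ_lt hlt), le_max_left _ _, fun d hd t ht => ?_⟩
  refine lt_max_of_lt_right (Order.lt_succ_of_le ?_)
  exact Ordinal.le_iSup
    (fun t : ↥(⋃ d ∈ D, {t | d.1.toFun t ≠ none}) => nodeHeight t.1)
    ⟨t, Set.mem_biUnion hd ht⟩

end Forcing

open SetTree Forcing in
theorem mainTheorem8 {T : Type u} [PartialOrder T] [IsTree T] (hT : IsGenAronszajn T)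
    (hlev : HasCountableLevels T) (p : Specializing T) (x : PName.{u, u} (Specializing T))
    (hx : p ⊩ isCountable x ⋏ isSetOfOrdinals x) :
    ∃ (h : SubsetName Cohen (Specializing T)) (y : PName.{u, 0} Cohen),
      (∀ q : Specializing T, q ⊩ h.isGeneric) ∧ (p ⊩ x ≐ y.evalBy h) := by
  have hccc : CCC (Specializing T) := Specializing.ccc hT.countable_chain isChain_Iic
  obtain ⟨hcount, hord⟩ := hx
  -- The ordinal `0` is added only to have a nonempty set to enumerate; it enters the evaluated name
  -- only through conditions forcing it into `x`.
  obtain ⟨a, ha⟩ := ((hccc.countable_ordinals hcount).insert 0).exists_eq_range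
    (Set.insert_nonempty _ _)
  choose D hD hDc hpre using fun n : ℕ => hccc.exists_countable_predense
    {r | r ⊩ ordName (Specializing T) (a n) ∊ x}
  obtain ⟨δ, hδ, hωδ, hdom⟩ := exists_nodeHeight_bound hT (Set.countable_iUnion hDc)
  have := countable_Trace hlev hδ
  obtain ⟨eQ, hQ⟩ := (atomless_Trace hT hωδ).exists_isDenseTree
  obtain ⟨eC, hC⟩ := cohen_atomless.exists_isDenseTree
  have hπ := isProjection_toTrace hT δ
  let h : SubsetName Cohen (Specializing T) := transferName (toTrace δ) eQ eC
  have htop : ∀ q, q ⊩ h.has ⊤ := fun q r _ => by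
    obtain ⟨s, -, r', hr', hs⟩ := hπ.exists_denseTree_le hQ r
    exact ⟨r', hr', r', ⟨s, hs, le_top⟩, le_rfl⟩
  -- The name `y` contains `a n` with condition `eC s` whenever the matching trace node `eQ s`
  -- guarantees some `d ∈ D n`.
  let I : Type u := ULift {c : ℕ × List ℕ // ∃ d ∈ D c.1, eQ c.2 ≤ toTrace δ d}
  refine ⟨h, .mk I (fun c => eC c.down.1.2) (fun c => ordName Cohen (a c.down.1.1)),
    transferName_isGeneric hπ hQ hC, ?_⟩
  obtain ⟨ι, c, z⟩ := x
  rw [PName.evalBy, PName.eq_mk_iff]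
  constructor
  -- Decide the element as some `a n`, extend into a `d ∈ D n`, and then below a tree node `eQ s`
  -- refining the trace of `d`; this puts `eC s` into the filter.
  · intro i q hq hi
    have hmem : q ⊩ z i ∊ PName.mk ι c z := PName.elt_mem hi
    obtain ⟨r, hr, α, e⟩ := exists_eq_ordName (hord (z i) q hq hmem)
    have hαx := PName.mem_congr_left e (PName.mem_mono hr hmem)
    obtain ⟨n, rfl⟩ : α ∈ Set.range a := ha ▸ Or.inr ⟨r, hr.trans hq, hαx⟩
    obtain ⟨d, hd, t, htr, htd⟩ := hpre n r hαx
    obtain ⟨s, hs, t', ht', hst'⟩ := hπ.exists_denseTree_le hQ t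
    refine ⟨t', ht'.trans (htr.trans hr),
      ⟨⟨(n, s), d, hd, hs.trans (hπ.mono htd)⟩, t', s, hst', le_rfl⟩, le_rfl, ?_⟩
    exact PName.eq_trans (PName.eq_mono (ht'.trans htr) e) (evalBy_ordName_eq htop _ _)
  -- If `eC s` is in the filter, the trace of `q` is below that of `d`; since `d` lives below `δ`,
  -- `q` extends `d` and so forces `a n` into `x`.
  · rintro ⟨⟨⟨n, s⟩, d, hd, hsd⟩, g, hg⟩ q hq hqg
    have hqs : toTrace δ q ≤ eQ s := (hπ.mono hqg).trans (le_of_mem_transferName hQ hC hg)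
    have hqd : q ≤ d := le_of_toTrace_le (hdom d (Set.mem_iUnion.2 ⟨n, hd⟩)) (hqs.trans hsd)
    obtain ⟨r, hr, i, hi, e⟩ := hD n hd q hqd
    exact ⟨r, hr, i, hi, PName.eq_trans (PName.eq_symm e) (evalBy_ordName_eq htop _ _)⟩
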